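/- Let $\lambda$ be a cardinal with $\lambda\ge\aleph_1$, and let $\lambda^+$ be its successor cardinal. If $2^\lambda=\lambda^+$, then the diamond principle $\diamondsuit(\lambda^+)$ holds. Here, for a regular uncountable cardinal $\kappa$, $\diamondsuit(\kappa)$ is the statement that there is a sequence $\langle A_\alpha:\alpha<\kappa\rangle$ of sets with $A_\alpha\subseteq\alpha$ for every $\alpha<\kappa$, such that for every subset $A\subseteq\kappa$ the set $\{\alpha<\kappa: A_\alpha=A\cap\alpha\}$ is stationary in $\kappa$, that is, meets every closed unbounded subset of $\kappa$. -/

import Mathlib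

open scoped Cardinal

universe u

/-- The diamond principle `◇(κ)` (of interest for regular uncountable `κ`). The type
`κ.ord.ToType` is the well-order of type `κ`; its elements stand for the ordinals `α < κ`, and
`Set.Iio α` is the ordinal `α` as the set of its predecessors. There is a sequence
`⟨A α : α < κ⟩` with `A α ⊆ α` such that every subset `X` of `κ` is guessed correctly,
`A α = X ∩ α`, for stationarily many `α < κ`. -/
def Diamond (κ : Cardinal.{u}) : Prop :=
  ∃ A : κ.ord.ToType → Set κ.ord.ToType,
    (∀ α, A α ⊆ Set.Iio α) ∧
    ∀ X : Set κ.ord.ToType, IsStationary {α | A α = X ∩ Set.Iio α}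

/-!
This is Shelah's theorem, by the argument of Komjáth. Write `K` for `λ⁺` and `L` for `λ`, as
well-orders. As `2 ^ λ = λ⁺`, there is an enumeration `X` in type `K` of the bounded subsets of `K`,
even of the `L × L`-matrices of such sets (`exists_code_initial_segments`). A matrix `Z` of arbitrary
subsets of `K` is thus described by the function sending `α` to the index of its restriction to `α`,
and the closure points of this function form a club (`isClub_setOf_forall_lt`).

Every `δ : K` is an increasing union of layers, indexed by `L` and of cardinality less than `λ`.
If the cofinality of `δ` differs from that of `λ` and `δ` is a closure point, then a single layer
contains cofinally many `α < δ` together with the index of the restriction to `α`. Such `δ` of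
cofinality `ℵ₀` or `ℵ₁` are stationary (`isStationary_setOf_cof_Iio_eq`), and this is where
`ℵ₁ ≤ λ` is needed. A diagonal argument over the rows of the matrices makes the index of the layer
independent of `δ` and of the sets to be guessed (`exists_layer_isStationary`).

Within the chosen layer, a second diagonal argument goes over the columns. Suppose that sets `Z σ`
for `σ < τ` are fixed, and keep those pairs `(α, β)` of elements of the layer of `δ` for which `β`
is right about each `Z σ` below `α`. If the `τ`-th column of the surviving `β` does not guess all
sets `Y`, take a set that is not guessed as `Z τ`, which eliminates a pair. This can be repeated
fewer than `λ` times, as the layer is small, so that some column guesses every `Y`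
(`exists_guesses_isStationary`). The union of the surviving guesses in this column is the diamond
sequence.
-/

open Cardinal Order Set

/-! ### Cofinality, clubs and stationary sets -/

/-- A map which tends to infinity preserves the cofinality, even if it is not monotone. -/
theorem Order.cof_congr_of_eventually_ge {α β : Type u} [LinearOrder α] [LinearOrder β]
    [NoMaxOrder β] (f : α → β) (hf : ∀ b, ∃ a, ∀ a', a ≤ a' → b ≤ f a') : cof α = cof β := by
  apply le_antisymm
  · obtain ⟨s, hs, hs'⟩ := exists_cof_eq β
    choose g hg using hf
    rw [← hs']
    refine (cof_le (s := g '' s) fun a ↦ ?_).trans mk_image_le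
    obtain ⟨b, hb⟩ := exists_gt (f a)
    obtain ⟨c, hc, hbc⟩ := hs b
    refine ⟨g c, mem_image_of_mem _ hc, le_of_not_ge fun h ↦ ?_⟩
    exact (hb.trans_le (hbc.trans (hg c a h))).false
  · obtain ⟨s, hs, hs'⟩ := exists_cof_eq α
    rw [← hs']
    refine (cof_le (s := f '' s) fun b ↦ ?_).trans mk_image_le
    obtain ⟨a, ha⟩ := hf b
    obtain ⟨a', ha', h⟩ := hs a
    exact ⟨f a', mem_image_of_mem _ ha', ha a' h⟩

theorem Order.exists_gt_of_mk_lt_cof {K : Type u} [LinearOrder K] {s : Set K} (hs : #s < cof K) :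
    ∃ x, ∀ y ∈ s, y < x :=
  not_isCofinal_iff.1 fun h ↦ (cof_le h).not_gt hs

theorem isClub_setOf_forall_lt {K : Type u} [LinearOrder K] [WellFoundedLT K]
    (hK : ℵ₀ < cof K) (hIic : ∀ a : K, #(Iic a) < cof K) (f : K → K) :
    IsClub {δ : K | ∀ α < δ, f α < δ} := by
  refine ⟨dirSupClosed_iff_of_linearOrder.2 fun d hd _ a ha α hα ↦ ?_, fun a ↦ ?_⟩
  · obtain ⟨b, hb, hαb⟩ := (lt_isLUB_iff ha).1 hα
    exact (hd hb α hαb).trans_le (ha.1 hb)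
  · have key (x : K) : ∃ y, ∀ z ≤ x, z < y ∧ f z < y := by
      obtain ⟨y, hy⟩ := exists_gt_of_mk_lt_cof (mk_image_le.trans_lt (hIic x) : #(f '' Iic x) < _)
      obtain ⟨y', hy'⟩ := exists_gt_of_mk_lt_cof (hIic x)
      exact ⟨max y y', fun z hz ↦ ⟨(hy' z hz).trans_le (le_max_right _ _),
        (hy _ (mem_image_of_mem _ hz)).trans_le (le_max_left _ _)⟩⟩
    choose g hg using key
    obtain ⟨u, hu⟩ : ∃ u, ∀ y ∈ range fun n ↦ g^[n] a, y < u :=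
      exists_gt_of_mk_lt_cof (lt_of_le_of_lt (by
        simpa using mk_range_le_lift (f := fun n : ℕ ↦ g^[n] a)) hK)
    -- The least upper bound of the iterates of `g` is a closure point of `f`.
    have hne : (upperBounds (range fun n ↦ g^[n] a)).Nonempty := ⟨u, fun y hy ↦ (hu y hy).le⟩
    let m := WellFounded.min (wellFounded_lt (α := K)) _ hne
    have hm : m ∈ upperBounds (range fun n ↦ g^[n] a) := WellFounded.min_mem _ _ hne
    refine ⟨m, fun α hα ↦ ?_, hm ⟨0, rfl⟩⟩
    obtain ⟨n, hn⟩ : ∃ n, α < g^[n] a := by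
      by_contra! h
      refine WellFounded.not_lt_min wellFounded_lt (upperBounds (range fun n ↦ g^[n] a)) ?_ hα
      rintro _ ⟨n, rfl⟩
      exact h n
    refine (hg _ α hn.le).2.trans_le (hm ⟨n + 1, ?_⟩)
    simp only [Function.iterate_succ_apply']

theorem nonempty_and_noMaxOrder_of_one_lt_cof {α : Type u} [LinearOrder α] (h : 1 < cof α) :
    Nonempty α ∧ NoMaxOrder α := by
  have : Nonempty α := cof_ne_zero_iff.1 (zero_le_one.trans_lt h).ne'
  exact ⟨this, (noTopOrder_iff_noMaxOrder α).1 (one_lt_cof_iff.1 h)⟩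

/-- A club contains points of each infinite cofinality which occurs below `K`, since its enumeration
is normal and hence preserves the cofinality of limit points. -/
theorem isStationary_setOf_cof_Iio_eq {K : Type u} [LinearOrder K] [WellFoundedLT K]
    [IsRegularCardinalOrder K] (a : K) (ha : 1 < cof (Iio a)) :
    IsStationary {δ : K | cof (Iio δ) = cof (Iio a)} := by
  intro C hC
  have hn := hC.isNormal_enum
  obtain ⟨⟨x⟩, _⟩ := nonempty_and_noMaxOrder_of_one_lt_cof ha
  have hlim : IsSuccLimit a := by
    refine ⟨fun h ↦ h.not_lt x.2, fun b hb ↦ ?_⟩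
    obtain ⟨y, hy⟩ := exists_gt (⟨b, hb.lt⟩ : Iio a)
    exact hb.2 (show b < y from hy) y.2
  refine ⟨_, ?_, (enum C hC.isCofinal a).2⟩
  let g : Iio a → Iio (enum C hC.isCofinal a : K) := fun y ↦ ⟨_, hn.strictMono y.2⟩
  refine (cof_congr_of_strictMono (f := g) (fun y z hyz ↦ hn.strictMono hyz) fun b ↦ ?_).symm
  obtain ⟨y, hy, hby⟩ := (hn.lt_iff_exists_lt hlim).1 b.2
  exact ⟨_, ⟨⟨y, hy⟩, rfl⟩, hby.le⟩

/-! ### Guessing -/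

section Guessing

variable {K L : Type u} [LinearOrder K]

/-- There are at most `#K * 2 ^ #L = #K` matrices of subsets of `K` with a common bound and with
rows and columns indexed by `L`, so that all of them occur in one enumeration `X` in type `K`. -/
theorem exists_code_initial_segments [Nonempty K] (hK : 2 ^ #L ≤ #K) (hL : ℵ₀ ≤ #L)
    (hIio : ∀ δ : K, #(Iio δ) ≤ #L) :
    ∃ X : K → L → L → Set K, ∀ (Z : L → L → Set K) (α : K), ∃ β,
      ∀ i τ, X β i τ = Z i τ ∩ Iio α := by
  let T := Σ α : K, (L → L → Set (Iio α))
  have hT : #T ≤ #K := by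
    have hK0 : ℵ₀ ≤ #K := hL.trans ((cantor _).le.trans hK)
    rw [mk_sigma]
    refine (sum_le_mk_mul_iSup _).trans ?_
    refine (mul_le_mul' le_rfl (ciSup_le' fun α ↦ ?_ : _ ≤ #K)).trans (mul_eq_self hK0).le
    have h : #(L → L → Set (Iio α)) = 2 ^ (#(Iio α) * #L * #L) := by
      simp only [mk_pi, prod_const, lift_id, mk_set, power_mul]
    rw [h]
    refine le_trans (power_le_power_left two_ne_zero ?_) hK
    calc #(Iio α) * #L * #L ≤ #L * #L * #L := by gcongr; exact hIio α
      _ = #L := by rw [mul_eq_self hL, mul_eq_self hL]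
  obtain ⟨e⟩ := hT
  have : Nonempty T := ⟨⟨Classical.arbitrary K, fun _ _ ↦ ∅⟩⟩
  refine ⟨fun β i τ ↦ Subtype.val '' (Function.invFun e β).2 i τ, fun Z α ↦ ?_⟩
  refine ⟨e ⟨α, fun i τ ↦ Subtype.val ⁻¹' Z i τ⟩, fun i τ ↦ ?_⟩
  have h := Function.leftInverse_invFun e.injective ⟨α, fun i τ ↦ Subtype.val ⁻¹' Z i τ⟩
  beta_reduce
  rw [h]
  simp [Subtype.image_preimage_coe, inter_comm]

variable [LinearOrder L]

/-- The `i`-th layer of `δ`, seen as its set of predecessors, with respect to injections `e δ` of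
`δ` into `L`: the predecessors with code below `i`. The layers of `δ` increase with `i` and have
union `δ`. -/
def layer (e : ∀ δ : K, Iio δ ↪ L) (i : L) (δ : K) : Set K :=
  Subtype.val '' (e δ ⁻¹' Iio i)

theorem mk_layer_lt (hL : ∀ i : L, #(Iio i) < #L) (e : ∀ δ : K, Iio δ ↪ L) (i : L) (δ : K) :
    #(layer e i δ) < #L :=
  mk_image_le.trans_lt ((mk_preimage_of_injective _ _ (e δ).injective).trans_lt (hL i))

/-- One row `i` can be chosen such that, for every sequence `Z` of subsets of `K`, the `i`-th layers
of stationarily many `δ` contain codes, taken from the `i`-th row of the enumeration `X`, of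
restrictions of `Z` to cofinally many `α < δ`. Otherwise counterexamples for the different rows
would assemble into one matrix that is handled by no row; but if `δ` is closed under coding the
restrictions of this matrix, then the difference of the cofinalities of `δ` and `L` yields a row
that works at `δ`. -/
theorem exists_layer_isStationary [WellFoundedLT K] [NoMaxOrder L]
    (hK : ℵ₀ < cof K) (hLK : #L < cof K) (hIic : ∀ a : K, #(Iic a) < cof K)
    (hS : IsStationary {δ : K | 1 < cof (Iio δ) ∧ cof (Iio δ) ≠ cof L})
    (X : K → L → L → Set K)
    (hX : ∀ (Z : L → L → Set K) (α : K), ∃ β, ∀ i τ, X β i τ = Z i τ ∩ Iio α)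
    (e : ∀ δ : K, Iio δ ↪ L) :
    ∃ i, ∀ Z : L → Set K, IsStationary {δ | ∀ γ < δ, ∃ α ∈ layer e i δ, γ < α ∧
      ∃ β ∈ layer e i δ, ∀ τ, X β i τ = Z τ ∩ Iio α} := by
  by_contra! hne
  simp only [not_isStationary_iff] at hne
  choose Z C hC hdisj using hne
  choose f hf using hX Z
  have hCf := (IsClub.iInter hK.ne' (by simpa using hLK) hC).inter hK.ne'
    (isClub_setOf_forall_lt hK hIic f)
  obtain ⟨δ, ⟨hδ1, hδ2⟩, hδC, hδf⟩ := hS hCf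
  obtain ⟨_, _⟩ := nonempty_and_noMaxOrder_of_one_lt_cof hδ1
  -- On `Iio δ`, the larger of the codes of `b` and `f b` does not tend to infinity in `L`.
  let f' : Iio δ → Iio δ := fun b ↦ ⟨f b, hδf b b.2⟩
  obtain ⟨i, hi⟩ : ∃ i, ∀ a : Iio δ, ∃ b, a ≤ b ∧ max (e δ b) (e δ (f' b)) < i := by
    by_contra! hg
    exact hδ2 (cof_congr_of_eventually_ge (fun b : Iio δ ↦ max (e δ b) (e δ (f' b))) hg)
  refine Set.disjoint_left.1 (hdisj i) (fun γ hγ ↦ ?_) (mem_iInter.1 hδC i)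
  obtain ⟨a, ha⟩ := exists_gt (⟨γ, hγ⟩ : Iio δ)
  obtain ⟨b, hab, hb⟩ := hi a
  rw [max_lt_iff] at hb
  exact ⟨b, ⟨b, hb.1, rfl⟩, (show γ < a from ha).trans_le hab, f b,
    ⟨f' b, hb.2, rfl⟩, fun τ ↦ hf b i τ⟩

/-- The pairs `(α, β)` of elements of `A` for which `β` codes, through `X`, the restrictions to `α`
of the sets `Z σ` with `σ < τ`. -/
def guesses (X : K → L → Set K) (A : Set K) (τ : L) (Z : ∀ σ < τ, Set K) : Set (K × K) :=
  {p | p.1 ∈ A ∧ p.2 ∈ A ∧ ∀ σ (hσ : σ < τ), X p.2 σ = Z σ hσ ∩ Iio p.1}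

/-- If for every sequence `Z` the small sets `A δ` contain codes of restrictions of `Z` cofinally
often, for stationarily many `δ`, then some column `τ` and some initial segment of a sequence make
all admissible guesses for the column `τ` correct: otherwise one could define a full sequence
`Z` by recursion, choosing `Z τ` such that the set of guesses shrinks strictly at `τ`, for each `τ`
and all `δ` in a club. Some `δ` would be in all of these clubs, and `A δ ×ˢ A δ` would have at
least `#L` elements. -/
theorem exists_guesses_isStationary [WellFoundedLT K] [WellFoundedLT L]
    (hK : ℵ₀ < cof K) (hLK : #L < cof K) (hL : ℵ₀ ≤ #L)
    (A : K → Set K) (hA : ∀ δ, #(A δ) < #L) (X : K → L → Set K)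
    (hX : ∀ Z : L → Set K, IsStationary {δ | ∀ γ < δ, ∃ α ∈ A δ, γ < α ∧
      ∃ β ∈ A δ, ∀ τ, X β τ = Z τ ∩ Iio α}) :
    ∃ (τ : L) (Z : ∀ σ < τ, Set K), ∀ Y : Set K, IsStationary {δ |
      (∀ γ < δ, ∃ p ∈ guesses X (A δ) τ Z, γ < p.1) ∧
      ∀ p ∈ guesses X (A δ) τ Z, X p.2 τ = Y ∩ Iio p.1} := by
  by_contra! hne
  simp only [not_isStationary_iff] at hne
  choose Y C hC hdisj using hne
  let Z : L → Set K := WellFoundedLT.fix Y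
  have hZ (τ : L) : Z τ = Y τ fun σ _ ↦ Z σ := WellFoundedLT.fix_eq Y τ
  obtain ⟨δ, hδ, hδC⟩ := hX Z (IsClub.iInter hK.ne' (by simpa using hLK)
    fun τ ↦ hC τ fun σ _ ↦ Z σ)
  have key (τ : L) : ∃ p ∈ guesses X (A δ) τ fun σ _ ↦ Z σ, X p.2 τ ≠ Z τ ∩ Iio p.1 := by
    by_contra! hτ
    refine Set.disjoint_left.1 (hdisj τ fun σ _ ↦ Z σ) ⟨fun γ hγ ↦ ?_, ?_⟩
      (mem_iInter.1 hδC τ)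
    · obtain ⟨α, hα, hγα, β, hβ, hαβ⟩ := hδ γ hγ
      exact ⟨(α, β), ⟨hα, hβ, fun σ _ ↦ hαβ σ⟩, hγα⟩
    · rw [← hZ]
      exact hτ
  choose p hp hpZ using key
  -- `p τ` leaves the set of guesses at `τ`, so it differs from all later choices.
  have hinj : Function.Injective p := by
    refine .of_lt_imp_ne fun σ τ hστ hpp ↦ hpZ σ ?_
    rw [hpp]
    exact (hp τ).2.2 σ hστ
  have hle : #L ≤ #(A δ ×ˢ A δ : Set (K × K)) :=
    mk_le_of_injective (f := fun τ ↦ ⟨p τ, (hp τ).1, (hp τ).2.1⟩) fun σ τ h ↦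
      hinj (Subtype.ext_iff.1 h)
  rw [mk_setProd] at hle
  exact hle.not_gt (mul_lt_of_lt hL (hA δ) (hA δ))

end Guessing

/-! ### The diamond sequence -/

theorem theorem2p3 (lam : Cardinal.{u}) (hlam : ℵ₁ ≤ lam) (h : 2 ^ lam = Order.succ lam) :
    Diamond (Order.succ lam) := by
  have hlam0 : ℵ₀ ≤ lam := aleph0_lt_aleph_one.le.trans hlam
  have hreg : (succ lam).IsRegular := isRegular_succ hlam0
  let K := (succ lam).ord.ToType
  let L := lam.ord.ToType
  have hmkL : #L = lam := mk_ord_toType lam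
  have hmkK : #K = succ lam := mk_ord_toType _
  have hcofK : cof K = succ lam := by rw [Ordinal.cof_toType, hreg.cof_ord]
  have : NoMaxOrder L := noMaxOrder hlam0
  have : NoMaxOrder K := noMaxOrder hreg.1
  have : IsRegularCardinalOrder K := ⟨by rw [hcofK]; simp [K]⟩
  have hIioK (δ : K) : #(Iio δ) ≤ #L := by
    rw [hmkL, ← lt_succ_iff]
    simpa [K] using mk_Iio_lt δ
  have hIioL (i : L) : #(Iio i) < #L := mk_Iio_lt i (by simp [L])
  have hIicK (δ : K) : #(Iic δ) < cof K := by
    obtain ⟨a, ha⟩ := exists_gt δ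
    refine (mk_le_mk_of_subset (Iic_subset_Iio.2 ha)).trans_lt ?_
    rw [hcofK, lt_succ_iff]
    exact (hIioK a).trans hmkL.le
  have hLK : #L < cof K := by rw [hmkL, hcofK]; exact lt_succ lam
  have hK : ℵ₀ < cof K := (hlam0.trans hmkL.ge).trans_lt hLK
  have : Nonempty K := by
    rw [← cof_ne_zero_iff]; exact (aleph0_pos.trans hK).ne'
  -- One of `ℵ₀` and `ℵ₁` differs from the cofinality of `lam`.
  have hS : IsStationary {δ : K | 1 < cof (Iio δ) ∧ cof (Iio δ) ≠ cof L} := by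
    obtain ⟨c, hc, hcL, hclam⟩ : ∃ c : Cardinal.{u}, c.IsRegular ∧ c ≠ cof L ∧ c ≤ lam := by
      by_cases hL0 : cof L = ℵ₀
      · exact ⟨ℵ₁, isRegular_aleph_one, hL0 ▸ aleph0_lt_aleph_one.ne', hlam⟩
      · exact ⟨ℵ₀, isRegular_aleph0, Ne.symm hL0, hlam0⟩
    let a : K := Ordinal.ToType.mk ⟨c.ord, ord_lt_ord.2 (lt_succ_of_le hclam)⟩
    have ha : cof (Iio a) = c := by
      rw [Order.cof_Iio, show Ordinal.typein (α := K) (· < ·) a = c.ord from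
        Ordinal.typein_enum _ _, hc.cof_ord]
    refine (isStationary_setOf_cof_Iio_eq a (ha ▸ one_lt_aleph0.trans_le hc.1)).mono fun δ hδ ↦ ?_
    rw [mem_ofPred_eq, ha] at hδ
    rw [mem_ofPred_eq, hδ]
    exact ⟨one_lt_aleph0.trans_le hc.1, hcL⟩
  obtain ⟨X, hX⟩ := exists_code_initial_segments (K := K) (L := L) (by rw [hmkL, h, hmkK])
    (hlam0.trans hmkL.ge) hIioK
  let e (δ : K) : Iio δ ↪ L := (hIioK δ).some
  obtain ⟨i, hi⟩ := exists_layer_isStationary hK hLK hIicK hS X hX e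
  obtain ⟨τ, Z, hZ⟩ := exists_guesses_isStationary hK hLK (hlam0.trans hmkL.ge)
    (layer e i) (mk_layer_lt hIioL e i) (fun β ↦ X β i) hi
  let V (δ : K) := guesses (fun β ↦ X β i) (layer e i δ) τ Z
  refine ⟨fun δ ↦ (⋃ p ∈ V δ, X p.2 i τ) ∩ Iio δ, fun _ ↦ inter_subset_right, fun Y ↦
    (hZ Y).mono fun δ hδ ↦ ?_⟩
  obtain ⟨hunb, hY⟩ := hδ
  ext x
  simp only [mem_inter_iff, mem_iUnion, mem_Iio, and_congr_left_iff, exists_prop]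
  intro hx
  constructor
  · rintro ⟨p, hp, hxp⟩
    rw [hY p hp] at hxp
    exact hxp.1
  · intro hxY
    obtain ⟨p, hp, hxp⟩ := hunb x hx
    exact ⟨p, hp, (hY p hp).ge ⟨hxY, hxp⟩⟩
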